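/- Let $\gamma>0$. Call a subset of $\mathbb R$ *locally finite* if it has finitely many points in every bounded interval. Let $C_p^0(\mathbb R)$ be the set of functions $f:\mathbb R\to\mathbb C$ whose set of discontinuity points is locally finite and which are absolutely integrable on every bounded interval (so integrable singularities at the discontinuities are allowed). Recursively, let $C_p^{l+1}(\mathbb R)$ be the set of continuous functions $f:\mathbb R\to\mathbb C$ that are differentiable outside a locally finite set, with derivative there equal to a function in $C_p^l(\mathbb R)$. Let $C_{p,\gamma}^l(\mathbb R)$ be the set of $\gamma$-periodic functions in $C_p^l(\mathbb R)$. Let $W,V\in C_{p,\gamma}^0(\mathbb R)$ (complex valued) and $\lambda\in\mathbb R$, and consider $$-\psi''+W\psi'+V\psi=\lambda\psi .\qquad(1)$$ A solution is a function $\psi\in C_p^2(\mathbb R)$ satisfying (1) outside a locally finite set. For $k\in\mathbb C$ write $[k]_\gamma=\{k+\tfrac{2m\pi}{\gamma}: m\in\mathbb Z\}\in\mathbb C/\tfrac{2\pi}{\gamma}\mathbb Z$. A number $k\in\mathbb C$ is called a quasimomentum of $\psi$ if, with functions $p,p_1,p_2\in C_{p,\gamma}^2(\mathbb R)$, one of the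 following holds: * $\psi(x)=e^{\mathrm ikx}p(x)$ with $p\not\equiv0$; * $\psi(x)=e^{\mathrm ikx}(p_1(x)+xp_2(x))$ with $p_2\not\equiv0$; * $\psi(x)=e^{\mathrm ikx}p_1(x)+e^{\mathrm ik'x}p_2(x)$ with $p_1\not\equiv0$, $p_2\not\equiv0$ and some $k'\in\mathbb C$ with $[k']_\gamma\ne[k]_\gamma$. Let $\mathcal A(\lambda)\subset\mathbb C/\tfrac{2\pi}{\gamma}\mathbb Z$ be the set of the classes $[k]_\gamma$ of all quasimomenta $k$ of all solutions of (1). **Theorem.** $|\mathcal A(\lambda)|\le2$. Moreover, let $\psi\in C_p^2(\mathbb R)$ be a solution of (1). If $\psi\not\equiv0$, then $\mathcal A(\lambda)\neq\emptyset$, and: * if $|\mathcal A(\lambda)|=1$ and $\mathcal A(\lambda)=\{[k_0]_\gamma\}$ with $k_0\in\mathbb C$, then either $\psi(x)=e^{\mathrm ik_0x}p(x)$ for some $p\in C_{p,\gamma}^2(\mathbb R)$, or $\psi(x)=e^{\mathrm ik_0x}(p_1(x)+xp_2(x))$ for some $p_1,p_2\in C_{p,\gamma}^2(\mathbb R)$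 with $p_2\not\equiv0$; * if $|\mathcal A(\lambda)|=2$ and $\mathcal A(\lambda)=\{[k_1]_\gamma,[k_2]_\gamma\}$ with $k_1,k_2\in\mathbb C$, then $\psi(x)=e^{\mathrm ik_1x}p_1(x)+e^{\mathrm ik_2x}p_2(x)$ for some $p_1,p_2\in C_{p,\gamma}^2(\mathbb R)$. (The two bulleted conclusions hold for the zero solution as well.) -/

import Mathlib

open scoped Real

/-- A set of real numbers that has only finitely many points in every bounded interval. -/
def FiniteOnBounded (S : Set ℝ) : Prop :=
  ∀ a b : ℝ, (S ∩ Set.Icc a b).Finite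

/-- Piecewise continuity: finitely many discontinuity points on every finite interval. -/
def IsPiecewiseContinuous (f : ℝ → ℂ) : Prop :=
  FiniteOnBounded {x | ¬ ContinuousAt f x}

/-- The class `C_p^l(ℝ)`.

`C_p^0(ℝ)` consists of the piecewise continuous functions that are (absolutely) integrable up to
each of their discontinuity points; for a piecewise continuous function this says exactly that it
is locally integrable. Unbounded singularities are allowed.

`C_p^(l+1)(ℝ)` consists of the continuous functions that have, away from a set of break points
which is finite on bounded intervals, a derivative belonging to `C_p^l(ℝ)` (the values of the
derivative at the break points being immaterial). -/
def IsCp : ℕ → (ℝ → ℂ) → Prop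
  | 0, f => IsPiecewiseContinuous f ∧ MeasureTheory.LocallyIntegrable f MeasureTheory.volume
  | l + 1, f => Continuous f ∧
      ∃ g : ℝ → ℂ, IsCp l g ∧ FiniteOnBounded {x | ¬ HasDerivAt f (g x) x}

/-- The class `C_{p,γ}^l(ℝ)` of the `γ`-periodic functions in `C_p^l(ℝ)`. -/
def IsCpPeriodic (γ : ℝ) (l : ℕ) (f : ℝ → ℂ) : Prop :=
  IsCp l f ∧ Function.Periodic f γ

/-- `ψ ∈ C_p^2(ℝ)` solves `-ψ'' + W ψ' + V ψ = μ ψ`. The equation is required away from break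
points, at which `ψ''` need not exist. -/
def IsSLSolution (W V : ℝ → ℂ) (μ : ℝ) (ψ : ℝ → ℂ) : Prop :=
  IsCp 2 ψ ∧
    FiniteOnBounded {x | ¬ (-deriv (deriv ψ) x + W x * deriv ψ x + V x * ψ x = (μ : ℂ) * ψ x)}

/-- The quotient `ℂ / (2π/γ)ℤ`. -/
abbrev QuasimomentumClass (γ : ℝ) : Type :=
  ℂ ⧸ AddSubgroup.zmultiples ((2 * π / γ : ℝ) : ℂ)

/-- The class `[k]_γ` of `k` modulo `2π/γ`. -/
noncomputable def quasiClass (γ : ℝ) (k : ℂ) : QuasimomentumClass γ :=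
  QuotientAddGroup.mk k

/-- `k` is a quasimomentum of `ψ`: it is the exponent of a nontrivial Bloch representation
`e^{ikx} p`, or the exponent of a representation `e^{ikx} (p₁ + x p₂)` with `p₂ ≢ 0`, or one of the
two exponents of a representation `e^{ikx} p₁ + e^{ik'x} p₂` with `[k] ≠ [k']` in which both terms
are nontrivial; all of `p, p₁, p₂` belong to `C_{p,γ}^2(ℝ)`. -/
def IsQuasimomentumOf (γ : ℝ) (ψ : ℝ → ℂ) (k : ℂ) : Prop :=
  (∃ p : ℝ → ℂ, IsCpPeriodic γ 2 p ∧ p ≠ 0 ∧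
    ∀ x : ℝ, ψ x = Complex.exp (Complex.I * k * x) * p x) ∨
  (∃ p₁ p₂ : ℝ → ℂ, IsCpPeriodic γ 2 p₁ ∧ IsCpPeriodic γ 2 p₂ ∧ p₂ ≠ 0 ∧
    ∀ x : ℝ, ψ x = Complex.exp (Complex.I * k * x) * (p₁ x + x * p₂ x)) ∨
  (∃ (k' : ℂ) (p₁ p₂ : ℝ → ℂ), quasiClass γ k ≠ quasiClass γ k' ∧
    IsCpPeriodic γ 2 p₁ ∧ IsCpPeriodic γ 2 p₂ ∧ p₁ ≠ 0 ∧ p₂ ≠ 0 ∧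
    ∀ x : ℝ, ψ x = Complex.exp (Complex.I * k * x) * p₁ x + Complex.exp (Complex.I * k' * x) * p₂ x)

/-- The set `𝒜(μ)` of the classes modulo `2π/γ` of the quasimomenta of the solutions of
`-ψ'' + W ψ' + V ψ = μ ψ`. -/
def quasimomentumClasses (γ : ℝ) (W V : ℝ → ℂ) (μ : ℝ) : Set (QuasimomentumClass γ) :=
  {c | ∃ (ψ : ℝ → ℂ) (k : ℂ), IsSLSolution W V μ ψ ∧ IsQuasimomentumOf γ ψ k ∧
    c = quasiClass γ k}

/-! This is Floquet theory. Translation by $\gamma$ is an endomorphism $T$ of the solution space.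
That space has dimension at most 2, because $(\psi(0),\psi'(0))$ determines a solution
(`IsSLSolution.eq_zero`); existence for given initial data is never needed.

By `quasiClass_mem_iff`, $[k]_\gamma\in\mathcal A$ exactly when $e^{ik\gamma}$ is an eigenvalue of
$T$, and the class is determined by this multiplier. Hence there are at most two classes. Over
$\mathbb C$, $T$ has an eigenvalue as soon as a nonzero solution exists. Two eigenvalues split
$\psi$ into eigenvectors, which are Bloch functions (`exists_bloch`); a single eigenvalue $\rho$
forces $(T-\rho)^2=0$, which gives the form with $p_1+xp_2$ (`exists_bloch_jordan`). -/

/-! ### Endomorphisms of complex spaces of dimension at most two. -/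

section LinearAlgebra

open Module

variable {E : Type*} [AddCommGroup E] [Module ℂ E] [FiniteDimensional ℂ E]

theorem encard_hasEigenvalue_le_finrank (T : End ℂ E) :
    {ρ : ℂ | T.HasEigenvalue ρ}.encard ≤ finrank ℂ E := by
  by_contra! h
  obtain ⟨t, ht, htc⟩ := Set.exists_subset_encard_eq (Order.add_one_le_of_lt h)
  have hfin : t.Finite := Set.finite_of_encard_eq_coe (k := finrank ℂ E + 1) (by simpa using htc)
  have := hfin.fintype
  choose v hv using fun ρ : t => End.HasEigenvalue.exists_hasEigenvector (ht ρ.2)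
  have hcard := (End.eigenvectors_linearIndependent T t v hv).fintype_card_le_finrank
  rw [Set.encard_eq_coe_toFinset_card, Set.toFinset_card] at htc
  have : Fintype.card t = finrank ℂ E + 1 := by exact_mod_cast htc
  omega

/-- Generalized eigenspaces span over $\mathbb C$, so the one for `ρ` is the whole space, and
exponent `finrank ℂ E ≤ 2` already exhausts it. -/
theorem sub_smul_sq_eq_zero_of_unique_eigenvalue (hE : finrank ℂ E ≤ 2) (T : End ℂ E) (ρ : ℂ)
    (h : ∀ ρ', T.HasEigenvalue ρ' → ρ' = ρ) (v : E) :
    T (T v - ρ • v) = ρ • (T v - ρ • v) := by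
  have htop : T.maxGenEigenspace ρ = ⊤ := by
    rw [eq_top_iff, ← End.iSup_maxGenEigenspace_eq_top T]
    refine iSup_le fun ρ' => ?_
    by_cases hρ : ρ' = ρ
    · rw [hρ]
    · have : ¬ T.HasUnifEigenvalue ρ' ⊤ := fun hc => hρ (h _ (hc.lt zero_lt_one))
      have hbot : T.maxGenEigenspace ρ' = ⊥ := by
        simpa [End.HasUnifEigenvalue] using this
      rw [hbot]
      exact bot_le
  have hv : v ∈ T.maxGenEigenspace ρ := htop ▸ Submodule.mem_top
  rw [End.maxGenEigenspace_eq_genEigenspace_finrank] at hv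
  have hv2 := (T.genEigenspace ρ).mono
    (show ((finrank ℂ E : ℕ) : ℕ∞) ≤ ((2 : ℕ) : ℕ∞) by exact_mod_cast hE) hv
  rw [End.mem_genEigenspace_nat, LinearMap.mem_ker, pow_two, Module.End.mul_apply] at hv2
  simpa [sub_eq_zero] using hv2

theorem exists_eigenvector_decomposition (hE : finrank ℂ E ≤ 2) (T : End ℂ E) {ρ₁ ρ₂ : ℂ}
    (hne : ρ₁ ≠ ρ₂) (h₁ : T.HasEigenvalue ρ₁) (h₂ : T.HasEigenvalue ρ₂) (v : E) :
    ∃ v₁ v₂ : E, v = v₁ + v₂ ∧ T v₁ = ρ₁ • v₁ ∧ T v₂ = ρ₂ • v₂ := by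
  obtain ⟨w₁, hw₁⟩ := h₁.exists_hasEigenvector
  obtain ⟨w₂, hw₂⟩ := h₂.exists_hasEigenvector
  have hli : LinearIndependent ℂ ![w₁, w₂] := by
    refine End.eigenvectors_linearIndependent' T ![ρ₁, ρ₂] ?_ _ ?_
    · intro i j hij
      fin_cases i <;> fin_cases j <;> simp_all
    · intro i
      fin_cases i <;> simpa
  have hcard := hli.fintype_card_le_finrank
  have hspan := hli.span_eq_top_of_card_eq_finrank (by simp at hcard ⊢; omega)
  have hv : v ∈ Submodule.span ℂ (Set.range ![w₁, w₂]) := hspan ▸ Submodule.mem_top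
  rw [Matrix.range_cons_cons_empty, Submodule.mem_span_pair] at hv
  obtain ⟨a, b, rfl⟩ := hv
  refine ⟨a • w₁, b • w₂, rfl, ?_, ?_⟩
  · rw [map_smul, hw₁.apply_eq_smul, smul_comm]
  · rw [map_smul, hw₂.apply_eq_smul, smul_comm]

end LinearAlgebra

/-! ### Locally finite sets and stability of the classes $C_p^l$. -/

namespace FiniteOnBounded

theorem empty : FiniteOnBounded ∅ := fun _ _ => by simp

theorem mono {S T : Set ℝ} (hT : FiniteOnBounded T) (h : S ⊆ T) : FiniteOnBounded S :=
  fun a b => (hT a b).subset (Set.inter_subset_inter_left _ h)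

theorem union {S T : Set ℝ} (hS : FiniteOnBounded S) (hT : FiniteOnBounded T) :
    FiniteOnBounded (S ∪ T) := fun a b => by
  rw [Set.union_inter_distrib_right]
  exact (hS a b).union (hT a b)

theorem countable {S : Set ℝ} (hS : FiniteOnBounded S) : S.Countable := by
  refine (Set.countable_iUnion fun n : ℕ => (hS (-n) n).countable).mono fun x hx => ?_
  obtain ⟨n, hn⟩ := exists_nat_ge |x|
  exact Set.mem_iUnion.2 ⟨n, hx, abs_le.1 hn⟩

theorem preimage_add_const {S : Set ℝ} (hS : FiniteOnBounded S) (c : ℝ) :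
    FiniteOnBounded {x | x + c ∈ S} := fun a b => by
  refine ((hS (a + c) (b + c)).image (· - c)).subset fun x hx => ?_
  exact ⟨x + c, ⟨hx.1, by linarith [hx.2.1], by linarith [hx.2.2]⟩, by simp⟩

end FiniteOnBounded

open MeasureTheory

theorem MeasureTheory.LocallyIntegrable.intervalIntegrable_real {f : ℝ → ℂ}
    (hf : LocallyIntegrable f volume) (a b : ℝ) : IntervalIntegrable f volume a b :=
  (hf.integrableOn_isCompact isCompact_uIcc).intervalIntegrable

theorem MeasureTheory.LocallyIntegrable.continuous_mul_real {e f : ℝ → ℂ}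
    (he : Continuous e) (hf : LocallyIntegrable f volume) :
    LocallyIntegrable (fun x => e x * f x) volume := by
  rw [locallyIntegrable_iff] at hf ⊢
  exact fun k hk => IntegrableOn.continuousOn_mul he.continuousOn (hf k hk) hk

namespace IsCp

theorem of_succ {f : ℝ → ℂ} : ∀ {l : ℕ}, IsCp (l + 1) f → IsCp l f := by
  intro l
  induction l generalizing f with
  | zero =>
    rintro ⟨hc, -⟩
    refine ⟨FiniteOnBounded.empty.mono fun x hx => hx hc.continuousAt, hc.locallyIntegrable⟩
  | succ l ih =>
    rintro ⟨hc, g, hg, hd⟩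
    exact ⟨hc, g, ih hg, hd⟩

theorem add {l : ℕ} {f₁ f₂ : ℝ → ℂ} (h₁ : IsCp l f₁) (h₂ : IsCp l f₂) :
    IsCp l (fun x => f₁ x + f₂ x) := by
  induction l generalizing f₁ f₂ with
  | zero =>
    refine ⟨(h₁.1.union h₂.1).mono fun x hx => ?_, h₁.2.add h₂.2⟩
    by_contra hc
    simp only [Set.mem_union, Set.mem_ofPred_eq, not_or, not_not] at hc hx
    exact hx (hc.1.add hc.2)
  | succ l ih =>
    obtain ⟨hc₁, g₁, hg₁, hd₁⟩ := h₁
    obtain ⟨hc₂, g₂, hg₂, hd₂⟩ := h₂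
    refine ⟨hc₁.add hc₂, _, ih hg₁ hg₂, (hd₁.union hd₂).mono fun x hx => ?_⟩
    by_contra hc
    simp only [Set.mem_union, Set.mem_ofPred_eq, not_or, not_not] at hc hx
    exact hx (hc.1.add hc.2)

/-- Leibniz rule by induction on `l`; smoothness of `e` passes to `deriv e`. It serves for the
factors $c$, $x$ and $e^{-ikx}$. -/
theorem contDiff_mul {l : ℕ} {e f : ℝ → ℂ} (he : ContDiff ℝ (⊤ : ℕ∞) e) (hf : IsCp l f) :
    IsCp l (fun x => e x * f x) := by
  induction l generalizing e f with
  | zero =>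
    refine ⟨hf.1.mono fun x hx hc => hx (he.continuous.continuousAt.mul hc),
      hf.2.continuous_mul_real he.continuous⟩
  | succ l ih =>
    have hf' := hf.of_succ
    obtain ⟨hc, g, hg, hd⟩ := hf
    have he' : ContDiff ℝ (⊤ : ℕ∞) (deriv e) := (contDiff_infty_iff_deriv.1 he).2
    refine ⟨he.continuous.mul hc, _, (ih he' hf').add (ih he hg), hd.mono fun x hx hc => hx ?_⟩
    exact ((he.differentiable (by simp)) x).hasDerivAt.mul hc

theorem comp_add_const {l : ℕ} {f : ℝ → ℂ} (hf : IsCp l f) (c : ℝ) :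
    IsCp l (fun x => f (x + c)) := by
  induction l generalizing f with
  | zero =>
    refine ⟨(hf.1.preimage_add_const c).mono fun x hx hc => hx ?_, ?_⟩
    · exact ContinuousAt.comp (f := fun x : ℝ => x + c) hc (by fun_prop)
    · have := hf.2
      rw [← map_add_right_eq_self volume c] at this
      exact (locallyIntegrable_map_homeomorph (Homeomorph.addRight c)).1 this
  | succ l ih =>
    obtain ⟨hc, g, hg, hd⟩ := hf
    refine ⟨by fun_prop, _, ih hg, (hd.preimage_add_const c).mono fun x hx hc => hx ?_⟩
    exact HasDerivAt.comp_add_const x c hc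

/-- A continuous function whose derivative off a locally finite set extends continuously is
continuously differentiable. -/
theorem exists_hasDerivAt {l : ℕ} {f : ℝ → ℂ} (hf : IsCp (l + 2) f) :
    ∃ g, IsCp (l + 1) g ∧ ∀ x, HasDerivAt f (g x) x := by
  obtain ⟨hc, g, hg, hd⟩ := hf
  refine ⟨g, hg, fun x => ?_⟩
  have hgc : Continuous g := hg.1
  have hint : f = fun y => f 0 + ∫ t in (0 : ℝ)..y, g t := by
    funext y
    rw [integral_eq_of_hasDerivAt_off_countable f g hd.countable hc.continuousOn
      (fun z hz => not_not.1 hz.2) (hgc.intervalIntegrable _ _)]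
    ring
  rw [hint]
  exact (hgc.integral_hasStrictDerivAt 0 x).hasDerivAt.const_add _

end IsCp

/-! ### The solution space, uniqueness for initial data, and translation. -/

section Solutions

variable {W V : ℝ → ℂ} {μ : ℝ} {ψ : ℝ → ℂ}

/-- Witnesses `g`, `h` for $\psi'$, $\psi''$ replace iterated `deriv`, whose value is meaningless at
break points; linearity and translation then act on the witnesses directly. -/
theorem isSLSolution_iff : IsSLSolution W V μ ψ ↔
    ∃ g h : ℝ → ℂ, (∀ x, HasDerivAt ψ (g x) x) ∧ Continuous g ∧ IsCp 0 h ∧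
      FiniteOnBounded {x | ¬ HasDerivAt g (h x) x} ∧
      FiniteOnBounded {x | ¬ h x = W x * g x + (V x - μ) * ψ x} := by
  constructor
  · rintro ⟨hψ, heq⟩
    obtain ⟨g, ⟨hgc, h, hh, hgh⟩, hd⟩ := IsCp.exists_hasDerivAt (l := 0) hψ
    refine ⟨g, h, hd, hgc, hh, hgh, (heq.union hgh).mono fun x hx => ?_⟩
    by_contra hc
    simp only [Set.mem_union, Set.mem_ofPred_eq, not_or, not_not] at hc hx
    have hg : deriv ψ = g := funext fun x => (hd x).deriv
    rw [hg, hc.2.deriv] at hc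
    exact hx (by linear_combination -hc.1)
  · rintro ⟨g, h, hd, hgc, hh, hgh, heq⟩
    have hc : Continuous ψ := continuous_iff_continuousAt.2 fun x => (hd x).continuousAt
    refine ⟨⟨hc, g, ⟨hgc, h, hh, hgh⟩, FiniteOnBounded.empty.mono fun x hx => hx (hd x)⟩,
      (heq.union hgh).mono fun x hx => ?_⟩
    by_contra hc
    simp only [Set.mem_union, Set.mem_ofPred_eq, not_or, not_not] at hc hx
    have hg : deriv ψ = g := funext fun x => (hd x).deriv
    rw [hg, hc.2.deriv] at hx
    exact hx (by linear_combination -hc.1)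

namespace IsSLSolution

theorem hasDerivAt (hψ : IsSLSolution W V μ ψ) (x : ℝ) : HasDerivAt ψ (deriv ψ x) x := by
  obtain ⟨g, -, hd, -⟩ := isSLSolution_iff.1 hψ
  exact (hd x).differentiableAt.hasDerivAt

theorem add {φ : ℝ → ℂ} (hψ : IsSLSolution W V μ ψ) (hφ : IsSLSolution W V μ φ) :
    IsSLSolution W V μ (ψ + φ) := by
  obtain ⟨g₁, h₁, hd₁, hc₁, hh₁, hg₁, he₁⟩ := isSLSolution_iff.1 hψ
  obtain ⟨g₂, h₂, hd₂, hc₂, hh₂, hg₂, he₂⟩ := isSLSolution_iff.1 hφ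
  refine isSLSolution_iff.2 ⟨fun x => g₁ x + g₂ x, fun x => h₁ x + h₂ x,
    fun x => (hd₁ x).add (hd₂ x), hc₁.add hc₂, hh₁.add hh₂,
    (hg₁.union hg₂).mono fun x hx => ?_, (he₁.union he₂).mono fun x hx => ?_⟩ <;>
  by_contra hc <;>
  simp only [Set.mem_union, Set.mem_ofPred_eq, not_or, not_not, Pi.add_apply] at hc hx
  · exact hx (hc.1.add hc.2)
  · exact hx (by linear_combination hc.1 + hc.2)

theorem const_smul (hψ : IsSLSolution W V μ ψ) (c : ℂ) : IsSLSolution W V μ (c • ψ) := by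
  obtain ⟨g, h, hd, hgc, hh, hgh, heq⟩ := isSLSolution_iff.1 hψ
  refine isSLSolution_iff.2 ⟨fun x => c * g x, fun x => c * h x,
    fun x => (hd x).const_mul c, hgc.const_mul c, hh.contDiff_mul contDiff_const,
    hgh.mono fun x hx hc => hx (hc.const_mul c), heq.mono fun x hx hc => hx ?_⟩
  simp only [Pi.smul_apply, smul_eq_mul]
  linear_combination c * hc

theorem zero : IsSLSolution W V μ 0 := by
  refine isSLSolution_iff.2 ⟨0, 0, fun x => hasDerivAt_const x 0, continuous_const,
    ⟨FiniteOnBounded.empty.mono fun x hx => hx continuousAt_const, locallyIntegrable_zero⟩,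
    FiniteOnBounded.empty.mono fun x hx => hx (hasDerivAt_const x 0),
    FiniteOnBounded.empty.mono fun x hx => hx (by simp)⟩

theorem comp_add_const {γ : ℝ} (hW : Function.Periodic W γ) (hV : Function.Periodic V γ)
    (hψ : IsSLSolution W V μ ψ) : IsSLSolution W V μ (fun x => ψ (x + γ)) := by
  obtain ⟨g, h, hd, hgc, hh, hgh, heq⟩ := isSLSolution_iff.1 hψ
  refine isSLSolution_iff.2 ⟨fun x => g (x + γ), fun x => h (x + γ),
    fun x => (hd _).comp_add_const x γ, by fun_prop, hh.comp_add_const γ,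
    (hgh.preimage_add_const γ).mono fun x hx hc => hx (HasDerivAt.comp_add_const x γ hc),
    (heq.preimage_add_const γ).mono fun x hx hc => hx ?_⟩
  rw [hW, hV] at hc
  exact hc

/-- A linear system with locally integrable coefficients: vanishing of the initial data at a point
propagates to a neighbourhood. -/
theorem eventually_eq_zero (hW : LocallyIntegrable W volume) (hV : LocallyIntegrable V volume)
    (hψ : IsSLSolution W V μ ψ) {x₀ : ℝ} (h₀ : ψ x₀ = 0) (h₁ : deriv ψ x₀ = 0) :
    ∀ᶠ x in nhds x₀, ψ x = 0 ∧ deriv ψ x = 0 := by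
  obtain ⟨g, h, hd, hgc, hh, hgh, heq⟩ := isSLSolution_iff.1 hψ
  have hg : deriv ψ = g := funext fun x => (hd x).deriv
  rw [hg] at h₁ ⊢
  have hψc : Continuous ψ := continuous_iff_continuousAt.2 fun x => (hd x).continuousAt
  -- `K` bounds, in the maximum norm, the coefficient matrix of the system $\psi'=g$,
  -- $g'=Wg+(V-\mu)\psi$.
  set K : ℝ → ℝ := fun t => 1 + ‖W t‖ + ‖V t - μ‖ with hK
  have hKi : ∀ a b, IntervalIntegrable K volume a b := fun a b =>
    (intervalIntegrable_const.add (hW.intervalIntegrable_real a b).norm).add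
      ((hV.intervalIntegrable_real a b).sub intervalIntegrable_const).norm
  have hprim : Continuous fun x => |∫ t in x₀..x, K t| :=
    (intervalIntegral.continuous_primitive hKi x₀).abs
  have hsmall : ∀ᶠ x in nhds x₀, |∫ t in x₀..x, K t| < 1 / 2 :=
    hprim.continuousAt.eventually_lt_const (by simp)
  -- On this ball integration against `K` contracts by 1/2, so the maximum `u m` of `u` will satisfy
  -- `u m ≤ u m / 2` and vanish.
  obtain ⟨δ, hδ, hball⟩ := Metric.nhds_basis_closedBall.eventually_iff.1 hsmall
  set u : ℝ → ℝ := fun t => max ‖ψ t‖ ‖g t‖ with hu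
  have huc : Continuous u := hψc.norm.max hgc.norm
  obtain ⟨m, hm, hmax⟩ := (isCompact_closedBall x₀ δ).exists_isMaxOn
    ⟨x₀, Metric.mem_closedBall_self hδ.le⟩ huc.continuousOn
  have hu0 : ∀ t, 0 ≤ u t := fun t => (norm_nonneg _).trans (le_max_left _ _)
  -- Used for both components: `F = ψ`, `f = g` and `F = g`, `f = h`.
  have hbound : ∀ x ∈ Metric.closedBall x₀ δ, ∀ f F : ℝ → ℂ, F x₀ = 0 →
      (∫ t in x₀..x, f t = F x - F x₀) → (∀ᵐ t, ‖f t‖ ≤ K t * u t) →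
      ‖F x‖ ≤ u m * (1 / 2) := by
    intro x hx f F hF hint hf
    have hsub : Set.uIcc x₀ x ⊆ Metric.closedBall x₀ δ := by
      rw [Real.closedBall_eq_Icc] at hx ⊢
      exact Set.uIcc_subset_Icc ⟨by linarith, by linarith⟩ hx
    have hle : ∀ᵐ t ∂volume.restrict (Set.uIoc x₀ x), ‖f t‖ ≤ u m * K t := by
      rw [ae_restrict_iff' measurableSet_uIoc]
      filter_upwards [hf] with t ht hmem
      have hK0 : 0 ≤ K t := by positivity
      rw [mul_comm]
      exact ht.trans (mul_le_mul_of_nonneg_left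
        (hmax (hsub (Set.uIoc_subset_uIcc hmem))) hK0)
    have := intervalIntegral.norm_integral_le_abs_of_norm_le hle ((hKi x₀ x).const_mul _)
    rw [hint, hF, sub_zero, intervalIntegral.integral_const_mul, abs_mul, abs_of_nonneg (hu0 m)]
      at this
    exact this.trans (mul_le_mul_of_nonneg_left (hball hx).le (hu0 m))
  have hum : ∀ x ∈ Metric.closedBall x₀ δ, u x ≤ u m * (1 / 2) := by
    intro x hx
    refine max_le (hbound x hx g ψ h₀ ?_ ?_) (hbound x hx h g h₁ ?_ ?_)
    · exact intervalIntegral.integral_eq_sub_of_hasDerivAt (fun t _ => hd t)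
        (hgc.intervalIntegrable _ _)
    · refine Filter.Eventually.of_forall fun t => ?_
      have h1 : 1 ≤ K t := by simp only [hK]; linarith [norm_nonneg (W t), norm_nonneg (V t - μ)]
      exact (le_max_right _ _).trans (le_mul_of_one_le_left (hu0 t) h1)
    · exact integral_eq_of_hasDerivAt_off_countable g h hgh.countable hgc.continuousOn
        (fun z hz => not_not.1 hz.2) (hh.2.intervalIntegrable_real _ _)
    · filter_upwards [heq.countable.ae_notMem volume] with t ht
      rw [not_not.1 ht]
      calc ‖W t * g t + (V t - μ) * ψ t‖ ≤ ‖W t‖ * ‖g t‖ + ‖V t - μ‖ * ‖ψ t‖ :=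
            (norm_add_le _ _).trans (by rw [norm_mul, norm_mul])
        _ ≤ ‖W t‖ * u t + ‖V t - μ‖ * u t := by
            gcongr
            · exact le_max_right _ _
            · exact le_max_left _ _
        _ ≤ K t * u t := by
            simp only [hK]
            linarith [hu0 t]
  have hm0 : u m ≤ 0 := by linarith [hum m hm]
  filter_upwards [Metric.closedBall_mem_nhds x₀ hδ] with x hx
  have hx0 : u x ≤ 0 := (hmax hx).trans hm0
  exact ⟨norm_le_zero_iff.1 ((le_max_left _ _).trans hx0),
    norm_le_zero_iff.1 ((le_max_right _ _).trans hx0)⟩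

/-- The common zero set of $\psi$ and $\psi'$ is closed by continuity and open by local uniqueness,
and $\mathbb R$ is connected. -/
theorem eq_zero (hW : LocallyIntegrable W volume) (hV : LocallyIntegrable V volume)
    (hψ : IsSLSolution W V μ ψ) (h₀ : ψ 0 = 0) (h₁ : deriv ψ 0 = 0) : ψ = 0 := by
  have hclopen : IsClopen {x | ψ x = 0 ∧ deriv ψ x = 0} := by
    refine ⟨?_, isOpen_iff_mem_nhds.2 fun x hx => hψ.eventually_eq_zero hW hV hx.1 hx.2⟩
    obtain ⟨g, -, hd, hgc, -⟩ := isSLSolution_iff.1 hψ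
    have hg : deriv ψ = g := funext fun x => (hd x).deriv
    have hψc : Continuous ψ := continuous_iff_continuousAt.2 fun x => (hd x).continuousAt
    rw [hg]
    exact (isClosed_eq hψc continuous_const).inter (isClosed_eq hgc continuous_const)
  have huniv := hclopen.eq_univ ⟨0, h₀, h₁⟩
  funext x
  exact (huniv ▸ Set.mem_univ x : x ∈ {x | ψ x = 0 ∧ deriv ψ x = 0}).1

end IsSLSolution

/-- The space of solutions. -/
def slSolutions (W V : ℝ → ℂ) (μ : ℝ) : Submodule ℂ (ℝ → ℂ) where
  carrier := {ψ | IsSLSolution W V μ ψ}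
  add_mem' h₁ h₂ := IsSLSolution.add h₁ h₂
  zero_mem' := IsSLSolution.zero
  smul_mem' c _ h := IsSLSolution.const_smul h c

/-- The value and the derivative of a solution at the origin. -/
noncomputable def slInitialData (W V : ℝ → ℂ) (μ : ℝ) : slSolutions W V μ →ₗ[ℂ] ℂ × ℂ where
  toFun ψ := (ψ.1 0, deriv ψ.1 0)
  map_add' ψ φ := by
    have hψ : IsSLSolution W V μ ψ.1 := ψ.2
    have hφ : IsSLSolution W V μ φ.1 := φ.2
    simp [((hψ.hasDerivAt 0).add (hφ.hasDerivAt 0)).deriv]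
  map_smul' c ψ := by
    have hψ : IsSLSolution W V μ ψ.1 := ψ.2
    simp [((hψ.hasDerivAt 0).const_smul c).deriv]

theorem slInitialData_injective (hW : LocallyIntegrable W volume)
    (hV : LocallyIntegrable V volume) : Function.Injective (slInitialData W V μ) := by
  rw [← LinearMap.ker_eq_bot, LinearMap.ker_eq_bot']
  intro ψ hψ
  rw [slInitialData, LinearMap.coe_mk, AddHom.coe_mk, Prod.mk_eq_zero] at hψ
  exact Subtype.ext (IsSLSolution.eq_zero hW hV ψ.2 hψ.1 hψ.2)

theorem finiteDimensional_slSolutions (hW : LocallyIntegrable W volume)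
    (hV : LocallyIntegrable V volume) : FiniteDimensional ℂ (slSolutions W V μ) :=
  FiniteDimensional.of_injective _ (slInitialData_injective hW hV)

theorem finrank_slSolutions_le (hW : LocallyIntegrable W volume)
    (hV : LocallyIntegrable V volume) : Module.finrank ℂ (slSolutions W V μ) ≤ 2 := by
  simpa using LinearMap.finrank_le_finrank_of_injective (slInitialData_injective (μ := μ) hW hV)

/-- Translation by a common period of the coefficients, acting on solutions. -/
def slTranslation {γ : ℝ} (hW : Function.Periodic W γ) (hV : Function.Periodic V γ) (μ : ℝ) :
    Module.End ℂ (slSolutions W V μ) where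
  toFun ψ := ⟨fun x => ψ.1 (x + γ), IsSLSolution.comp_add_const hW hV ψ.2⟩
  map_add' _ _ := rfl
  map_smul' _ _ := rfl

end Solutions

/-! ### Bloch functions, quasimomenta and Floquet multipliers. -/

section Quasimomenta

variable {γ : ℝ}

theorem quasiClass_eq_iff (hγ : 0 < γ) {k k' : ℂ} : quasiClass γ k = quasiClass γ k' ↔
    Complex.exp (Complex.I * k * γ) = Complex.exp (Complex.I * k' * γ) := by
  have hγ' : (γ : ℂ) ≠ 0 := by exact_mod_cast hγ.ne'
  -- The swap makes the coset difference $k-k'$, so the same integer `n` serves on both sides.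
  rw [eq_comm, quasiClass, quasiClass, QuotientAddGroup.eq, AddSubgroup.mem_zmultiples_iff,
    Complex.exp_eq_exp_iff_exists_int]
  refine exists_congr fun n => ?_
  push_cast
  rw [zsmul_eq_mul]
  constructor
  · intro h
    have h2 : (n : ℂ) * (2 * π) = (k - k') * γ := by
      field_simp at h
      linear_combination h
    linear_combination -Complex.I * h2
  · intro h
    have h2 : (n : ℂ) * (2 * π) = (k - k') * γ :=
      mul_left_cancel₀ Complex.I_ne_zero (by linear_combination -h)
    field_simp
    linear_combination h2

theorem exists_exp_mul_eq (hγ : 0 < γ) {ρ : ℂ} (hρ : ρ ≠ 0) :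
    ∃ k : ℂ, Complex.exp (Complex.I * k * γ) = ρ := by
  have hγ' : (γ : ℂ) ≠ 0 := by exact_mod_cast hγ.ne'
  refine ⟨Complex.log ρ / (Complex.I * γ), ?_⟩
  rw [show Complex.I * (Complex.log ρ / (Complex.I * γ)) * γ = Complex.log ρ by
    field_simp [Complex.I_ne_zero], Complex.exp_log hρ]

theorem contDiff_exp_mul (k : ℂ) :
    ContDiff ℝ (⊤ : ℕ∞) fun x : ℝ => Complex.exp (k * x) :=
  (contDiff_const.mul Complex.ofRealCLM.contDiff).cexp

theorem exp_mul_add (k : ℂ) (x : ℝ) : Complex.exp (Complex.I * k * (x + γ : ℝ)) =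
    Complex.exp (Complex.I * k * γ) * Complex.exp (Complex.I * k * x) := by
  rw [← Complex.exp_add]
  push_cast
  ring_nf

/-- A function of class `C_p^2` that translation by `γ` multiplies by `e^{ikγ}` is a Bloch
function. -/
theorem exists_bloch {k : ℂ} {φ : ℝ → ℂ} (hφ : IsCp 2 φ)
    (h : ∀ x, φ (x + γ) = Complex.exp (Complex.I * k * γ) * φ x) :
    ∃ p, IsCpPeriodic γ 2 p ∧ ∀ x : ℝ, φ x = Complex.exp (Complex.I * k * x) * p x := by
  refine ⟨fun x => Complex.exp (-(Complex.I * k) * x) * φ x,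
    ⟨hφ.contDiff_mul (contDiff_exp_mul _), fun x => ?_⟩, fun x => ?_⟩
  · have hne := Complex.exp_ne_zero (Complex.I * k * γ)
    have := exp_mul_add (γ := γ) (-k) x
    rw [mul_neg, neg_mul _ (γ : ℂ), Complex.exp_neg] at this
    simp only [this, h]
    field_simp
  · rw [← mul_assoc, ← Complex.exp_add]
    simp

theorem IsCp.ofReal_mul {l : ℕ} {f : ℝ → ℂ} (hf : IsCp l f) : IsCp l (fun x => (x : ℂ) * f x) :=
  hf.contDiff_mul Complex.ofRealCLM.contDiff

/-- A function of class `C_p^2` annihilated by the square of `T - e^{ikγ}`, where `T` is translation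
by `γ`. -/
theorem exists_bloch_jordan (hγ : 0 < γ) {k : ℂ} {ψ φ : ℝ → ℂ} (hψ : IsCp 2 ψ) (hφ : IsCp 2 φ)
    (h₁ : ∀ x, ψ (x + γ) = Complex.exp (Complex.I * k * γ) * ψ x + φ x)
    (h₂ : ∀ x, φ (x + γ) = Complex.exp (Complex.I * k * γ) * φ x) :
    ∃ p₁ p₂, IsCpPeriodic γ 2 p₁ ∧ IsCpPeriodic γ 2 p₂ ∧
      ∀ x : ℝ, ψ x = Complex.exp (Complex.I * k * x) * (p₁ x + x * p₂ x) := by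
  have hγ' : (γ : ℂ) ≠ 0 := by exact_mod_cast hγ.ne'
  have hne := Complex.exp_ne_zero (Complex.I * k * γ)
  set ρ := Complex.exp (Complex.I * k * γ) with hρ
  -- Translating $x\,c\varphi$ gives $\rho x\,c\varphi+\rho\gamma c\,\varphi$; this `c` makes the
  -- extra term $\varphi$, so $\psi-x\,c\varphi$ is multiplied by $\rho$.
  set c : ℂ := (ρ * γ)⁻¹ with hc
  have hcρ : c * (ρ * γ) = 1 := inv_mul_cancel₀ (mul_ne_zero hne hγ')
  have hφc : IsCp 2 fun x => c * φ x := hφ.contDiff_mul contDiff_const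
  obtain ⟨p₂, hp₂, he₂⟩ := exists_bloch (γ := γ) (k := k) hφc
    fun x => by simp only [h₂, ← hρ]; ring
  have hχ : IsCp 2 fun x : ℝ => ψ x + -1 * ((x : ℂ) * (c * φ x)) :=
    hψ.add (hφc.ofReal_mul.contDiff_mul contDiff_const)
  obtain ⟨p₁, hp₁, he₁⟩ := exists_bloch (γ := γ) (k := k) hχ fun x => by
    simp only [h₁, h₂, ← hρ]
    push_cast
    linear_combination (-φ x) * hcρ
  refine ⟨p₁, p₂, hp₁, hp₂, fun x => ?_⟩
  linear_combination he₁ x + x * he₂ x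

variable {W V : ℝ → ℂ} {μ : ℝ}

theorem quasiClass_mem_of_translation_eq {φ : ℝ → ℂ} {k : ℂ} (hφ : IsSLSolution W V μ φ)
    (hne : φ ≠ 0) (h : ∀ x, φ (x + γ) = Complex.exp (Complex.I * k * γ) * φ x) :
    quasiClass γ k ∈ quasimomentumClasses γ W V μ := by
  obtain ⟨p, hp, he⟩ := exists_bloch hφ.1 h
  refine ⟨φ, k, hφ, Or.inl ⟨p, hp, ?_, he⟩, rfl⟩
  rintro rfl
  exact hne (funext fun x => by simp [he])

theorem exists_ne_zero_of_exp_mul {k : ℂ} {c : ℂ} (hc : c ≠ 0) {p φ : ℝ → ℂ} (hp : p ≠ 0)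
    (h : ∀ x : ℝ, φ x = c * (Complex.exp (Complex.I * k * x) * p x)) : φ ≠ 0 := by
  obtain ⟨x, hx⟩ := Function.ne_iff.1 hp
  refine Function.ne_iff.2 ⟨x, ?_⟩
  rw [h]
  exact mul_ne_zero hc (mul_ne_zero (Complex.exp_ne_zero _) hx)

/-- A quasimomentum of a solution yields a Bloch solution. -/
theorem IsQuasimomentumOf.exists_translation_eq (hγ : 0 < γ) (hW : Function.Periodic W γ)
    (hV : Function.Periodic V γ) {ψ : ℝ → ℂ} {k : ℂ} (hψ : IsSLSolution W V μ ψ)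
    (hk : IsQuasimomentumOf γ ψ k) :
    ∃ φ, IsSLSolution W V μ φ ∧ φ ≠ 0 ∧
      ∀ x, φ (x + γ) = Complex.exp (Complex.I * k * γ) * φ x := by
  have hγ' : (γ : ℂ) ≠ 0 := by exact_mod_cast hγ.ne'
  -- Applying $T-e^{ik\gamma}$ in the Jordan case kills $p_1$ and turns $xp_2$ into a multiple of
  -- $p_2$; applying $T-e^{ik'\gamma}$ in the two-exponent case kills $p_2$. The remaining factor is
  -- nonzero.
  have hT : ∀ c : ℂ, IsSLSolution W V μ ((fun x => ψ (x + γ)) + c • ψ) := fun c =>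
    (hψ.comp_add_const hW hV).add (hψ.const_smul c)
  suffices H : ∃ (φ p : ℝ → ℂ) (c : ℂ), IsSLSolution W V μ φ ∧ c ≠ 0 ∧ p ≠ 0 ∧
      Function.Periodic p γ ∧ ∀ x : ℝ, φ x = c * (Complex.exp (Complex.I * k * x) * p x) by
    obtain ⟨φ, p, c, hφ, hc, hp, hper, he⟩ := H
    refine ⟨φ, hφ, exists_ne_zero_of_exp_mul hc hp he, fun x => ?_⟩
    rw [he, he, hper, exp_mul_add]
    ring
  rcases hk with ⟨p, hp, hp0, he⟩ | ⟨p₁, p₂, hp₁, hp₂, hp0, he⟩ | ⟨k', p₁, p₂, hkk, hp₁, hp₂, hp0, -, he⟩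
  · exact ⟨ψ, p, 1, hψ, one_ne_zero, hp0, hp.2, fun x => by rw [he, one_mul]⟩
  · refine ⟨_, p₂, Complex.exp (Complex.I * k * γ) * γ, hT (-Complex.exp (Complex.I * k * γ)),
      mul_ne_zero (Complex.exp_ne_zero _) hγ', hp0, hp₂.2, fun x => ?_⟩
    simp only [Pi.add_apply, Pi.smul_apply, smul_eq_mul]
    rw [he, he, hp₁.2, hp₂.2, exp_mul_add]
    push_cast
    ring
  · refine ⟨_, p₁, Complex.exp (Complex.I * k * γ) - Complex.exp (Complex.I * k' * γ),
      hT (-Complex.exp (Complex.I * k' * γ)),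
      sub_ne_zero.2 fun h => hkk ((quasiClass_eq_iff hγ).2 h), hp0, hp₁.2, fun x => ?_⟩
    simp only [Pi.add_apply, Pi.smul_apply, smul_eq_mul]
    rw [he, he, hp₁.2, hp₂.2, exp_mul_add, exp_mul_add]
    ring

/-- The quasimomenta are the logarithms of the eigenvalues of the translation. -/
theorem quasiClass_mem_iff (hγ : 0 < γ) (hW : Function.Periodic W γ) (hV : Function.Periodic V γ)
    (k : ℂ) : quasiClass γ k ∈ quasimomentumClasses γ W V μ ↔
      (slTranslation hW hV μ).HasEigenvalue (Complex.exp (Complex.I * k * γ)) := by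
  constructor
  · rintro ⟨ψ, k', hψ, hk', hkk⟩
    obtain ⟨φ, hφ, hne, he⟩ := hk'.exists_translation_eq hγ hW hV hψ
    rw [(quasiClass_eq_iff hγ).1 hkk]
    refine Module.End.hasEigenvalue_of_hasEigenvector (x := (⟨φ, hφ⟩ : slSolutions W V μ)) ?_
    refine ⟨Module.End.mem_eigenspace_iff.2 (Subtype.ext (funext he)), fun h => hne ?_⟩
    exact congrArg Subtype.val h
  · intro h
    obtain ⟨φ, hφ⟩ := h.exists_hasEigenvector
    refine quasiClass_mem_of_translation_eq φ.2 (fun h0 => hφ.2 (Subtype.ext h0)) fun x => ?_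
    exact congrFun (congrArg Subtype.val hφ.apply_eq_smul) x

/-- Translation is injective. This is what gives every eigenvalue a logarithm, hence a
quasimomentum. -/
theorem ne_zero_of_hasEigenvalue_slTranslation {hW : Function.Periodic W γ}
    {hV : Function.Periodic V γ} {ρ : ℂ} (h : (slTranslation hW hV μ).HasEigenvalue ρ) :
    ρ ≠ 0 := by
  rintro rfl
  obtain ⟨φ, hφ⟩ := h.exists_hasEigenvector
  refine hφ.2 (Subtype.ext (funext fun x => ?_))
  have : φ.1 (x - γ + γ) = (0 : ℂ) * φ.1 (x - γ) :=
    congrFun (congrArg Subtype.val hφ.apply_eq_smul) (x - γ)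
  simpa using this

end Quasimomenta

/-! ### The theorem, read off from the eigenvalues of the translation. -/

theorem mainTheorem1 (γ : ℝ) (hγ : 0 < γ) (W V : ℝ → ℂ)
    (hW : IsCpPeriodic γ 0 W) (hV : IsCpPeriodic γ 0 V) (μ : ℝ) :
    (quasimomentumClasses γ W V μ).encard ≤ 2 ∧
    ∀ ψ : ℝ → ℂ, IsSLSolution W V μ ψ →
      (ψ ≠ 0 → (quasimomentumClasses γ W V μ).Nonempty) ∧
      ((quasimomentumClasses γ W V μ).encard = 1 →
        ∀ k₀ : ℂ, quasimomentumClasses γ W V μ = {quasiClass γ k₀} →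
          (∃ p : ℝ → ℂ, IsCpPeriodic γ 2 p ∧
            ∀ x : ℝ, ψ x = Complex.exp (Complex.I * k₀ * x) * p x) ∨
          (∃ p₁ p₂ : ℝ → ℂ, IsCpPeriodic γ 2 p₁ ∧ IsCpPeriodic γ 2 p₂ ∧ p₂ ≠ 0 ∧
            ∀ x : ℝ, ψ x = Complex.exp (Complex.I * k₀ * x) * (p₁ x + x * p₂ x))) ∧
      ((quasimomentumClasses γ W V μ).encard = 2 →
        ∀ k₁ k₂ : ℂ, quasimomentumClasses γ W V μ = {quasiClass γ k₁, quasiClass γ k₂} →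
          ∃ p₁ p₂ : ℝ → ℂ, IsCpPeriodic γ 2 p₁ ∧ IsCpPeriodic γ 2 p₂ ∧
            ∀ x : ℝ, ψ x = Complex.exp (Complex.I * k₁ * x) * p₁ x
              + Complex.exp (Complex.I * k₂ * x) * p₂ x) := by
  have := finiteDimensional_slSolutions (μ := μ) hW.1.2 hV.1.2
  have hrank := finrank_slSolutions_le (μ := μ) hW.1.2 hV.1.2
  have hmem := quasiClass_mem_iff (μ := μ) hγ hW.2 hV.2
  set T := slTranslation hW.2 hV.2 μ with hT
  have hlog : ∀ ρ, T.HasEigenvalue ρ → ∃ k : ℂ, Complex.exp (Complex.I * k * γ) = ρ :=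
    fun ρ hρ => exists_exp_mul_eq hγ (ne_zero_of_hasEigenvalue_slTranslation hρ)
  refine ⟨?_, fun ψ hψ => ⟨fun hne => ?_, fun _ k₀ hk₀ => ?_, fun hcard k₁ k₂ hk => ?_⟩⟩
  -- The multiplier map $[k]_\gamma\mapsto e^{ik\gamma}$ embeds $\mathcal A$ into the set of
  -- eigenvalues.
  · have hinj : Set.InjOn (Quotient.lift (fun k : ℂ => Complex.exp (Complex.I * k * γ))
        fun a b h => (quasiClass_eq_iff hγ).1 (Quotient.sound h))
        (quasimomentumClasses γ W V μ) := by
      intro a _ b _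
      induction a using Quotient.inductionOn
      induction b using Quotient.inductionOn
      exact fun h => (quasiClass_eq_iff hγ).2 h
    rw [← hinj.encard_image]
    refine (Set.encard_le_encard ?_).trans ((encard_hasEigenvalue_le_finrank T).trans
      (by exact_mod_cast hrank))
    rintro _ ⟨a, ha, rfl⟩
    induction a using Quotient.inductionOn
    exact (hmem _).1 ha
  · have : Nontrivial (slSolutions W V μ) :=
      ⟨⟨ψ, hψ⟩, 0, fun h => hne (congrArg Subtype.val h)⟩
    obtain ⟨ρ, hρ⟩ := Module.End.exists_eigenvalue T
    obtain ⟨k, rfl⟩ := hlog ρ hρ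
    exact ⟨_, (hmem k).2 hρ⟩
  · have huniq : ∀ ρ, T.HasEigenvalue ρ → ρ = Complex.exp (Complex.I * k₀ * γ) := by
      intro ρ hρ
      obtain ⟨k, rfl⟩ := hlog ρ hρ
      have := (hmem k).2 hρ
      rw [hk₀] at this
      exact (quasiClass_eq_iff hγ).1 this
    have hsq := sub_smul_sq_eq_zero_of_unique_eigenvalue hrank T _ huniq ⟨ψ, hψ⟩
    -- $(T-\rho)\psi$ is again a solution, hence of class $C_p^2$.
    have hφ := (T ⟨ψ, hψ⟩ - Complex.exp (Complex.I * k₀ * γ) • ⟨ψ, hψ⟩ : slSolutions W V μ).2.1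
    obtain ⟨p₁, p₂, hp₁, hp₂, he⟩ := exists_bloch_jordan hγ hψ.1 hφ
      (fun x => (add_sub_cancel _ _).symm) (fun x => congrFun (congrArg Subtype.val hsq) x)
    by_cases hp0 : p₂ = 0
    · exact Or.inl ⟨p₁, hp₁, fun x => by simp [he, hp0]⟩
    · exact Or.inr ⟨p₁, p₂, hp₁, hp₂, hp0, he⟩
  -- Equal multipliers would collapse the pair to one class, against cardinality 2.
  · have hne : Complex.exp (Complex.I * k₁ * γ) ≠ Complex.exp (Complex.I * k₂ * γ) := by
      intro h
      rw [hk, (quasiClass_eq_iff hγ).2 h, Set.pair_eq_singleton, Set.encard_singleton] at hcard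
      norm_num at hcard
    obtain ⟨v₁, v₂, hv, hv₁, hv₂⟩ := exists_eigenvector_decomposition hrank T hne
      ((hmem k₁).1 (hk ▸ Set.mem_insert _ _)) ((hmem k₂).1 (hk ▸ Set.mem_insert_of_mem _ rfl))
      ⟨ψ, hψ⟩
    obtain ⟨p₁, hp₁, he₁⟩ := exists_bloch v₁.2.1 (congrFun (congrArg Subtype.val hv₁))
    obtain ⟨p₂, hp₂, he₂⟩ := exists_bloch v₂.2.1 (congrFun (congrArg Subtype.val hv₂))
    refine ⟨p₁, p₂, hp₁, hp₂, fun x => ?_⟩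
    rw [← he₁, ← he₂]
    exact congrFun (congrArg Subtype.val hv) x
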